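/- Let $s$ be the space of all complex sequences $x=(\xi_n)_{n\ge 0}$, each identified with the series $\xi_0+\xi_1+\cdots$, and let $T(\xi_n)=(\xi_{n+1})$. A *summation method* is a linear functional $\sigma:L\to\mathbb C$ on a $T$-invariant linear subspace $L\subset s$ such that $\sigma(x)=\xi_0+\sigma(Tx)$ for all $x\in L$. A series of functions $\sum_n\xi_n(t)$ *is summable on* $A\subset\mathbb R$ *to* $\psi$ if there is one summation method $\sigma:L\to\mathbb C$ such that $(\xi_n(t))_n\in L$ and $\sigma((\xi_n(t))_n)=\psi(t)$ for every $t\in A$; it is summable a.e. if this holds on a set $A$ whose complement has Lebesgue measure zero. **Theorem.** Let $q\ge 2$ be an integer. 1. Let $\theta:\mathbb R\to\mathbb C$ be $2\pi$-periodic and Lebesgue integrable on $(0,2\pi)$ with $\int_0^{2\pi}\theta(t)\,dt=0$. Then the series $\theta(t)+\theta(qt)+\theta(q^2t)+\cdots$ is summable a.e.; more precisely, there is a set $A\subset\mathbb R$ of full measure, with $A+2\pi=A$ and $qA\subset A$, such that the series is summable on $A$ to some $2\pi$-periodic function $\psi$. 2. For $\theta$ as in 1, whenever $qA\subset A$ and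 the series $\theta(t)+\theta(qt)+\theta(q^2t)+\cdots$ is summable on $A$ to $\psi$ by some summation method, $\psi(t)-\psi(qt)=\theta(t)$ for all $t\in A$. 3. Let $\theta(t)=\sum_{i=1}^m(a_i\cos\nu_it+b_i\sin\nu_it)$ with positive integers $\nu_i$ and complex coefficients $a_i,b_i$ that are not all zero, and suppose that for $i>j$ the ratio $\nu_i/\nu_j$ is not of the form $q^k$ with $k\in\mathbb Z$. Then every $2\pi$-periodic function $\psi:\mathbb R\to\mathbb C$ with $\psi(t)-\psi(qt)=\theta(t)$ for almost every $t$ is Lebesgue nonmeasurable. Moreover, the series $\sum_{n\ge0}\sin 3^nt$ is summable a.e., and every function to which it is summable a.e., by any summation method, is Lebesgue nonmeasurable. The same holds for the series $\sum_{n\ge0}\cos 2^nt$. -/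

import Mathlib

/-- The shift `T (ξ₀, ξ₁, …) = (ξ₁, ξ₂, …)` on the space of all complex sequences.  A sequence is
identified with the series of its terms. -/
def seriesShift (x : ℕ → ℂ) : ℕ → ℂ := fun n => x (n + 1)

/-- A summation method: a linear functional `σ` on a shift-invariant linear subspace `L` of the
space of all complex sequences, such that `σ x = ξ₀ + σ (T x)` for all `x = (ξₙ)` in `L`. -/
structure SummationMethod where
  /-- The subspace `L` of the series to which the method applies. -/
  domain : Submodule ℂ (ℕ → ℂ)
  shift_mem : ∀ x ∈ domain, seriesShift x ∈ domain
  /-- The functional `σ`. -/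
  sum : domain →ₗ[ℂ] ℂ
  sum_eq : ∀ (x : ℕ → ℂ) (hx : x ∈ domain),
    sum ⟨x, hx⟩ = x 0 + sum ⟨seriesShift x, shift_mem x hx⟩

/-- The functional series `X` is `σ`-summable at every point of `A`, and its sum there is `ψ`. -/
def SummationMethod.SumsOn (σ : SummationMethod) (X : ℝ → ℕ → ℂ) (A : Set ℝ) (ψ : ℝ → ℂ) : Prop :=
  ∀ t ∈ A, ∃ h : X t ∈ σ.domain, σ.sum ⟨X t, h⟩ = ψ t

/-- The orbital series `θ(t) + θ(qt) + θ(q²t) + …`. -/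
def orbitalSeries (q : ℕ) (θ : ℝ → ℂ) (t : ℝ) : ℕ → ℂ := fun n => θ ((q : ℝ) ^ n * t)

open MeasureTheory AddCircle Filter Topology

/-! Existence. A shift-invariant space carries a summation method as soon as its only constant
sequence is zero, because the functional taking the first term then factors through the identity
minus the shift (`exists_summationMethod`). The space used is `cesaroNull ns`: all tails have Cesàro
means tending to zero along a sequence `ns` of times. Almost every orbital series lies in it:
multiplication by `q` satisfies the mean ergodic theorem in L¹, checked on characters, and L¹
convergence gives almost everywhere convergence along a subsequence, so no pointwise ergodic theorem
is needed.

Nonmeasurability. If `Ψ x - Ψ (q • x)` is the given trigonometric polynomial, its orbit sums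
telescope to `S N x = Ψ x - Ψ (q ^ N • x)`. For measurable `Ψ` these differences are bounded in
probability uniformly in `N`, since multiplication preserves measure. But lacunarity gives a second
moment equal to `B * N` with `B > 0` and a fourth moment at most `C * N ^ 2`, so `S N` has size of
order `√N` on a set of measure bounded below, a contradiction
(`not_ae_sub_comp_nsmul_eq_sum_fourier`). -/

/-! ### Summation methods and orbital series -/

/-- A shift-invariant space of series without nonzero constant sequences is the domain of a
summation method. -/
theorem exists_summationMethod (L : Submodule ℂ (ℕ → ℂ)) (hL : ∀ x ∈ L, seriesShift x ∈ L)
    (hconst : ∀ x ∈ L, seriesShift x = x → x 0 = 0) :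
    ∃ σ : SummationMethod, σ.domain = L := by
  let S : L →ₗ[ℂ] L :=
    { toFun := fun x => ⟨seriesShift x, hL x x.2⟩
      map_add' := fun _ _ => rfl
      map_smul' := fun _ _ => rfl }
  let e : Module.Dual ℂ L := (LinearMap.proj 0 : (ℕ → ℂ) →ₗ[ℂ] ℂ) ∘ₗ L.subtype
  -- In the algebraic dual, a functional factors through `id - S` exactly when it kills the kernel,
  -- here the constant sequences in `L`.
  have he : e ∈ LinearMap.range (LinearMap.id - S).dualMap := by
    rw [LinearMap.range_dualMap_eq_dualAnnihilator_ker, Submodule.mem_dualAnnihilator]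
    intro x hx
    refine hconst x x.2 ?_
    have h : x - S x = 0 := by simpa using hx
    exact (congrArg Subtype.val (sub_eq_zero.1 h)).symm
  obtain ⟨φ, hφ⟩ := he
  refine ⟨⟨L, hL, φ, fun x hx => ?_⟩, rfl⟩
  have h := LinearMap.congr_fun hφ ⟨x, hx⟩
  have h' : φ ⟨x, hx⟩ - φ ⟨seriesShift x, hL x hx⟩ = x 0 := by
    rw [← map_sub]; exact h
  rw [← h']; ring

theorem SummationMethod.SumsOn.sub_eq {σ : SummationMethod} {X : ℝ → ℕ → ℂ} {A : Set ℝ}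
    {ψ : ℝ → ℂ} (h : σ.SumsOn X A ψ) {s t : ℝ} (ht : t ∈ A) (hs : s ∈ A)
    (hst : seriesShift (X t) = X s) : ψ t - ψ s = X t 0 := by
  obtain ⟨h₁, e₁⟩ := h t ht
  obtain ⟨h₂, e₂⟩ := h s hs
  have h₃ := σ.sum_eq (X t) h₁
  simp only [hst] at h₃
  rw [← e₁, ← e₂, h₃]; ring

open Classical in
/-- The sum of a series by the method `σ`, and `0` if `σ` does not apply to it. -/
noncomputable def SummationMethod.extendedSum (σ : SummationMethod) (x : ℕ → ℂ) : ℂ :=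
  if h : x ∈ σ.domain then σ.sum ⟨x, h⟩ else 0

theorem SummationMethod.sumsOn_extendedSum (σ : SummationMethod) (X : ℝ → ℕ → ℂ) :
    σ.SumsOn X {t | X t ∈ σ.domain} fun t => σ.extendedSum (X t) :=
  fun t ht => ⟨ht, by simp only [SummationMethod.extendedSum]; rw [dif_pos]⟩

theorem SummationMethod.SumsOn.eq_extendedSum {σ : SummationMethod} {X : ℝ → ℕ → ℂ} {A : Set ℝ}
    {ψ : ℝ → ℂ} (h : σ.SumsOn X A ψ) {t : ℝ} (ht : t ∈ A) : ψ t = σ.extendedSum (X t) := by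
  obtain ⟨h₁, h₂⟩ := h t ht
  rw [← h₂, SummationMethod.extendedSum, dif_pos h₁]

theorem seriesShift_orbitalSeries (q : ℕ) (θ : ℝ → ℂ) (t : ℝ) :
    seriesShift (orbitalSeries q θ t) = orbitalSeries q θ (q * t) := by
  funext n
  simp only [seriesShift, orbitalSeries, pow_succ, mul_assoc]

theorem orbitalSeries_add_period {T : ℝ} (q : ℕ) {θ : ℝ → ℂ} (hθ : Function.Periodic θ T)
    (t : ℝ) : orbitalSeries q θ (t + T) = orbitalSeries q θ t := by
  funext n
  have := hθ.nat_mul (q ^ n) ((q : ℝ) ^ n * t)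
  simp only [orbitalSeries, mul_add]
  exact_mod_cast this

/-! ### Passage between periodic functions on the line and functions on the circle -/

section Circle

variable {T : ℝ} [hT : Fact (0 < T)]

theorem ae_coe_of_ae_addCircle {P : AddCircle T → Prop}
    (h : ∀ᵐ x ∂(volume : Measure (AddCircle T)), P x) : ∀ᵐ t : ℝ, P (t : AddCircle T) := by
  have h₁ : ∀ n : ℤ, ∀ᵐ t : ℝ ∂volume.restrict (Set.Ioc (n • T) (n • T + T)),
      P (t : AddCircle T) :=
    fun n => (AddCircle.measurePreserving_mk T (n • T)).quasiMeasurePreserving.ae h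
  have h₂ : ∀ᵐ t : ℝ ∂volume.restrict (⋃ n : ℤ, Set.Ioc (n • T) (n • T + T)),
      P (t : AddCircle T) := (ae_restrict_iUnion_iff _ _).2 h₁
  have h₃ : (⋃ n : ℤ, Set.Ioc (n • T) (n • T + T)) = Set.univ := by
    simpa [add_smul] using iUnion_Ioc_zsmul hT.out
  rwa [h₃, Measure.restrict_univ] at h₂

theorem measurePreserving_coe_equivIoc (a : ℝ) :
    MeasurePreserving (fun x : AddCircle T => (equivIoc T a x : ℝ)) volume
      (volume.restrict (Set.Ioc a (a + T))) :=
  (measurePreserving_subtype_coe measurableSet_Ioc).comp (measurePreserving_equivIoc T)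

theorem ae_addCircle_of_ae_coe {P : AddCircle T → Prop} (h : ∀ᵐ t : ℝ, P (t : AddCircle T)) :
    ∀ᵐ x ∂(volume : Measure (AddCircle T)), P x := by
  have h₁ := (measurePreserving_coe_equivIoc (T := T) 0).quasiMeasurePreserving.ae
    (ae_restrict_of_ae h)
  filter_upwards [h₁] with x hx
  rwa [coe_equivIoc] at hx

theorem periodic_lift_eq {f : ℝ → ℂ} (hf : Function.Periodic f T) (a : ℝ) :
    hf.lift = fun x : AddCircle T => f (equivIoc T a x) := by
  funext x
  conv_lhs => rw [← coe_equivIoc (p := T) (a := a) (y := x)]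
  exact hf.lift_coe _

theorem ae_haar_iff_ae_volume {P : AddCircle T → Prop} :
    (∀ᵐ x ∂haarAddCircle, P x) ↔ ∀ᵐ x ∂(volume : Measure (AddCircle T)), P x := by
  rw [volume_eq_smul_haarAddCircle, Measure.ae_ennreal_smul_measure_eq]
  simpa using hT.out

theorem aestronglyMeasurable_periodic_lift {f : ℝ → ℂ} (hf : Function.Periodic f T)
    (hm : AEStronglyMeasurable f) : AEStronglyMeasurable hf.lift (haarAddCircle (T := T)) := by
  have h : AEStronglyMeasurable hf.lift (volume : Measure (AddCircle T)) := by
    rw [periodic_lift_eq hf 0]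
    exact hm.restrict.comp_measurePreserving (measurePreserving_coe_equivIoc 0)
  exact h.mono_ac (Measure.AbsolutelyContinuous.mk fun s _ hs => by
    rw [volume_eq_smul_haarAddCircle] at hs
    simpa [hT.out.not_ge] using hs)

theorem memLp_one_periodic_lift {f : ℝ → ℂ} (hf : Function.Periodic f T)
    (hi : IntervalIntegrable f volume 0 T) : MemLp hf.lift 1 (haarAddCircle (T := T)) := by
  rw [memLp_haarAddCircle_iff, periodic_lift_eq hf 0]
  refine MemLp.comp_measurePreserving ?_ (measurePreserving_coe_equivIoc 0)
  rw [memLp_one_iff_integrable, zero_add]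
  exact (intervalIntegrable_iff_integrableOn_Ioc_of_le hT.out.le).1 hi

theorem integral_periodic_lift {f : ℝ → ℂ} (hf : Function.Periodic f T) :
    ∫ x, hf.lift x ∂haarAddCircle (T := T) = T⁻¹ • ∫ t in (0 : ℝ)..T, f t := by
  rw [integral_haarAddCircle]
  congr 1
  have := AddCircle.intervalIntegral_preimage T 0 hf.lift
  rw [← this, zero_add]
  simp

theorem measurePreserving_nsmul_haar {q : ℕ} (hq : q ≠ 0) :
    MeasurePreserving (fun x : AddCircle T => q • x) haarAddCircle haarAddCircle := by
  have := Measure.measurePreserving_zsmul (haarAddCircle (T := T)) (n := (q : ℤ)) (by simpa using hq)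
  simpa using this

theorem ae_forall_pow_nsmul {q : ℕ} (hq : q ≠ 0) {P : AddCircle T → Prop}
    (h : ∀ᵐ x ∂haarAddCircle (T := T), P x) :
    ∀ᵐ x ∂haarAddCircle (T := T), ∀ j : ℕ, P (q ^ j • x) :=
  ae_all_iff.2 fun j =>
    (measurePreserving_nsmul_haar (pow_ne_zero j hq)).quasiMeasurePreserving.ae h

theorem integral_fourier (n : ℤ) :
    ∫ x, fourier n x ∂haarAddCircle (T := T) = if n = 0 then 1 else 0 := by
  have := congrFun (fourierCoeff_fourier (T := T) n) 0
  rw [fourierCoeff, Pi.single_apply] at this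
  simpa [eq_comm] using this

omit hT in
theorem fourier_nsmul (k : ℤ) (q : ℕ) (x : AddCircle T) :
    fourier k (q • x) = fourier (k * q) x := by
  rw [fourier_apply, fourier_apply, mul_smul, natCast_zsmul]

end Circle

/-! ### Orthogonality of characters and the mean ergodic theorem -/

section Circle
variable {T : ℝ} [hT : Fact (0 < T)]

/-- Frequencies may repeat here: the fourth moment bound needs to count coincidences. -/
theorem integral_norm_sq_sum_fourier {ι : Type*} (s : Finset ι) (k : ι → ℤ) (c : ι → ℂ) :
    ((∫ x, ‖∑ i ∈ s, c i * fourier (k i) x‖ ^ 2 ∂haarAddCircle (T := T) : ℝ) : ℂ) =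
      ∑ i ∈ s, ∑ j ∈ s, if k i = k j then c i * (starRingEnd ℂ) (c j) else 0 := by
  have h : ∀ x : AddCircle T, ((‖∑ i ∈ s, c i * fourier (k i) x‖ ^ 2 : ℝ) : ℂ) =
      ∑ i ∈ s, ∑ j ∈ s, c i * (starRingEnd ℂ) (c j) * fourier (k i - k j) x := by
    intro x
    rw [Complex.ofReal_pow, ← Complex.mul_conj', map_sum, Finset.sum_mul_sum]
    refine Finset.sum_congr rfl fun i _ => Finset.sum_congr rfl fun j _ => ?_
    rw [map_mul, ← fourier_neg, sub_eq_add_neg, fourier_add]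
    ring
  have hc : ∀ i j, Integrable (fun x : AddCircle T =>
      c i * (starRingEnd ℂ) (c j) * fourier (k i - k j) x) haarAddCircle := fun i j =>
    ((map_continuous (fourier (k i - k j))).integrable_of_hasCompactSupport
      (HasCompactSupport.of_compactSpace _)).const_mul _
  rw [← integral_complex_ofReal]
  simp_rw [h]
  rw [integral_finsetSum _ fun i _ => integrable_finsetSum _ fun j _ => hc i j]
  refine Finset.sum_congr rfl fun i _ => ?_
  rw [integral_finsetSum _ fun j _ => hc i j]
  refine Finset.sum_congr rfl fun j _ => ?_
  rw [integral_const_mul, integral_fourier]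
  simp [sub_eq_zero]

theorem integral_norm_sq_sum_fourier_of_injOn {ι : Type*} (s : Finset ι) (k : ι → ℤ) (c : ι → ℂ)
    (hk : Set.InjOn k s) :
    ∫ x, ‖∑ i ∈ s, c i * fourier (k i) x‖ ^ 2 ∂haarAddCircle (T := T) = ∑ i ∈ s, ‖c i‖ ^ 2 := by
  apply Complex.ofReal_injective
  rw [integral_norm_sq_sum_fourier, Complex.ofReal_sum]
  refine Finset.sum_congr rfl fun i hi => ?_
  rw [Finset.sum_eq_single_of_mem i hi]
  · simp [Complex.mul_conj']
  · intro j hj hji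
    rw [if_neg fun h => hji (hk hj hi h.symm)]

theorem integral_norm_sq_sum_fourier_eq_card {ι : Type*} (s : Finset ι) (k : ι → ℤ) :
    ∫ x, ‖∑ i ∈ s, fourier (k i) x‖ ^ 2 ∂haarAddCircle (T := T) =
      ∑ i ∈ s, ((s.filter fun j => k i = k j).card : ℝ) := by
  apply Complex.ofReal_injective
  have := integral_norm_sq_sum_fourier (T := T) s k (fun _ => 1)
  simp only [one_mul, map_one] at this
  rw [this]
  push_cast
  simp

theorem injective_mul_pow {k : ℤ} (hk : k ≠ 0) {q : ℕ} (hq : 2 ≤ q) :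
    Function.Injective fun n : ℕ => k * (q : ℤ) ^ n := by
  intro m n h
  have h' : (q : ℤ) ^ m = (q : ℤ) ^ n := mul_left_cancel₀ hk h
  exact Nat.pow_right_injective hq (by exact_mod_cast h')

/-- The `N` frequencies are distinct, so the average has L² norm exactly `1 / √N`, which dominates
its L¹ norm. -/
theorem norm_average_fourierLp_le {k : ℤ} (hk : k ≠ 0) {q : ℕ} (hq : 2 ≤ q) {N : ℕ} (hN : 0 < N) :
    ‖(N : ℂ)⁻¹ • ∑ n ∈ Finset.range N, fourierLp (T := T) 1 (k * (q : ℤ) ^ n)‖ ≤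
      (Real.sqrt N)⁻¹ := by
  set G : C(AddCircle T, ℂ) := (N : ℂ)⁻¹ • ∑ n ∈ Finset.range N, fourier (k * (q : ℤ) ^ n)
    with hG
  have h₁ : (N : ℂ)⁻¹ • ∑ n ∈ Finset.range N, fourierLp (T := T) 1 (k * (q : ℤ) ^ n) =
      ContinuousMap.toLp (E := ℂ) 1 haarAddCircle ℂ G := by
    rw [hG, map_smul, map_sum]
  have h₂ : ∫ x, ‖G x‖ ^ 2 ∂haarAddCircle = (N : ℝ)⁻¹ := by
    have := integral_norm_sq_sum_fourier_of_injOn (T := T) (Finset.range N)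
      (fun n => k * (q : ℤ) ^ n) (fun _ => (N : ℂ)⁻¹) (injective_mul_pow hk hq).injOn
    have h₃ : ∀ x, G x = ∑ n ∈ Finset.range N, (N : ℂ)⁻¹ * fourier (k * (q : ℤ) ^ n) x := by
      intro x
      simp [hG, Finset.mul_sum]
    simp_rw [h₃]
    rw [this]
    simp
    field_simp
  have hi : ∀ f : AddCircle T → ℝ, Continuous f → Integrable f haarAddCircle := fun f hf =>
    hf.integrable_of_hasCompactSupport (HasCompactSupport.of_compactSpace _)
  have h₀ : (fun x => ‖ContinuousMap.toLp (E := ℂ) 1 haarAddCircle ℂ G x‖) =ᵐ[haarAddCircle]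
      fun x => ‖G x‖ := (ContinuousMap.coeFn_toLp haarAddCircle G).fun_comp norm
  rw [h₁, L1.norm_eq_integral_norm, integral_congr_ae h₀]
  have hN' : (0 : ℝ) < N := by exact_mod_cast hN
  have hs : 0 < Real.sqrt N := Real.sqrt_pos.2 hN'
  calc ∫ x, ‖G x‖ ∂haarAddCircle
      ≤ ∫ x, (Real.sqrt N * ‖G x‖ ^ 2 + (Real.sqrt N)⁻¹) / 2 ∂haarAddCircle := by
        -- `2 * u ≤ √N * u ^ 2 + 1 / √N` pointwise takes the place of Cauchy–Schwarz.
        refine integral_mono (hi _ (by fun_prop)) (hi _ (by fun_prop)) fun x => ?_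
        have h₄ := mul_nonneg hs.le (sq_nonneg (‖G x‖ - (Real.sqrt N)⁻¹))
        have h₅ : Real.sqrt N * (Real.sqrt N)⁻¹ = 1 := mul_inv_cancel₀ hs.ne'
        have h₆ : Real.sqrt N * (‖G x‖ - (Real.sqrt N)⁻¹) ^ 2 =
            Real.sqrt N * ‖G x‖ ^ 2 - 2 * ‖G x‖ * (Real.sqrt N * (Real.sqrt N)⁻¹)
              + (Real.sqrt N * (Real.sqrt N)⁻¹) * (Real.sqrt N)⁻¹ := by ring
        rw [h₆, h₅] at h₄
        dsimp only
        linarith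
    _ = (Real.sqrt N)⁻¹ := by
        rw [integral_div, integral_add (hi _ (by fun_prop)) (integrable_const _),
          integral_const_mul, h₂]
        simp
        rw [show (N : ℝ)⁻¹ = (Real.sqrt N)⁻¹ * (Real.sqrt N)⁻¹ by
          rw [← mul_inv, Real.mul_self_sqrt hN'.le], ← mul_assoc, mul_inv_cancel₀ hs.ne']
        ring

theorem compMeasurePreserving_iterate_fourierLp {q : ℕ} (hq : q ≠ 0) (k : ℤ) (n : ℕ) :
    (Lp.compMeasurePreserving (E := ℂ) (p := 1) _ (measurePreserving_nsmul_haar (T := T) hq))^[n]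
      (fourierLp 1 k) = fourierLp 1 (k * (q : ℤ) ^ n) := by
  induction n with
  | zero => simp
  | succ n ih =>
    rw [Function.iterate_succ_apply', ih]
    apply Lp.ext
    have hmp := measurePreserving_nsmul_haar (T := T) hq
    filter_upwards [Lp.coeFn_compMeasurePreserving (fourierLp 1 (k * (q : ℤ) ^ n)) hmp,
      hmp.quasiMeasurePreserving.ae (coeFn_fourierLp 1 (k * (q : ℤ) ^ n)),
      coeFn_fourierLp (T := T) 1 (k * (q : ℤ) ^ (n + 1))] with x h₁ h₂ h₃
    rw [h₁, Function.comp_apply, h₂, h₃, fourier_nsmul, pow_succ, mul_assoc]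

/-- The mean ergodic theorem in `L¹` for multiplication by `q` on the circle. -/
theorem tendsto_birkhoffAverage_Lp_nsmul {q : ℕ} (hq : 2 ≤ q)
    (f : Lp ℂ 1 (haarAddCircle (T := T))) :
    Tendsto (fun N => birkhoffAverage ℂ (Lp.compMeasurePreserving (E := ℂ) (p := 1) _
        (measurePreserving_nsmul_haar (T := T) (q := q) (by omega))) id N f) atTop
      (𝓝 ((∫ x, f x ∂haarAddCircle) • fourierLp 1 0)) := by
  set U := Lp.compMeasurePreserving (E := ℂ) (p := 1) _
        (measurePreserving_nsmul_haar (T := T) (q := q) (by omega)) with hU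
  -- Composition is an isometry, so the averages are equicontinuous and convergence survives limits
  -- in `f`. The good `f` thus form a closed subspace, and the characters, whose span is dense,
  -- suffice.
  have hclosed : IsClosed {f : Lp ℂ 1 (haarAddCircle (T := T)) |
      Tendsto (fun N => birkhoffAverage ℂ U id N f) atTop
        (𝓝 ((∫ x, f x ∂haarAddCircle) • fourierLp 1 0))} :=
    isClosed_setOfPred_tendsto_birkhoffAverage ℂ
      (Lp.isometry_compMeasurePreserving _).lipschitz uniformContinuous_id
      (continuous_integral.smul continuous_const)
  let W : Submodule ℂ (Lp ℂ 1 (haarAddCircle (T := T))) :=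
    { carrier := {f | Tendsto (fun N => birkhoffAverage ℂ U id N f) atTop
        (𝓝 ((∫ x, f x ∂haarAddCircle) • fourierLp 1 0))}
      add_mem' := by
        intro f g hf hg
        have h₁ : ∫ x, (f + g) x ∂haarAddCircle =
            ∫ x, f x ∂haarAddCircle + ∫ x, g x ∂haarAddCircle := by
          rw [integral_congr_ae (Lp.coeFn_add f g)]
          exact integral_add (L1.integrable_coeFn f) (L1.integrable_coeFn g)
        simp only [Set.mem_ofPred_eq] at hf hg ⊢
        rw [h₁, add_smul]
        convert hf.add hg using 2 with N
        simp [birkhoffAverage, birkhoffSum, iterate_map_add, Finset.sum_add_distrib]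
      zero_mem' := by
        have h₁ : ∫ x, (0 : Lp ℂ 1 (haarAddCircle (T := T))) x ∂haarAddCircle = 0 := by
          rw [integral_congr_ae (Lp.coeFn_zero ..)]
          simp
        simp only [Set.mem_ofPred_eq]
        rw [h₁]
        simp [birkhoffAverage, birkhoffSum, iterate_map_zero]
      smul_mem' := by
        intro c f hf
        have h₁ : ∫ x, (c • f) x ∂haarAddCircle = c * ∫ x, f x ∂haarAddCircle := by
          rw [integral_congr_ae (Lp.coeFn_smul c f)]
          exact integral_const_mul c _
        have h₂ : ∀ n (g : Lp ℂ 1 (haarAddCircle (T := T))), U^[n] (c • g) = c • U^[n] g := by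
          intro n
          induction n with
          | zero => intro g; rfl
          | succ n ih =>
            intro g
            rw [Function.iterate_succ_apply, Function.iterate_succ_apply, ← ih]
            exact congrArg _ ((Lp.compMeasurePreservingₗ ℂ _ _).map_smul c g)
        simp only [Set.mem_ofPred_eq] at hf ⊢
        rw [h₁, mul_smul]
        convert hf.const_smul c using 2 with N
        simp [birkhoffAverage, birkhoffSum, h₂, ← Finset.smul_sum, smul_comm c] }
  have hspan : Submodule.span ℂ (Set.range (fourierLp (T := T) 1)) ≤ W := by
    rw [Submodule.span_le]
    rintro _ ⟨k, rfl⟩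
    change Tendsto (fun N => birkhoffAverage ℂ U id N _) atTop _
    have h₁ : ∫ x, (fourierLp 1 k : Lp ℂ 1 (haarAddCircle (T := T))) x ∂haarAddCircle =
        if k = 0 then 1 else 0 := by
      rw [integral_congr_ae (coeFn_fourierLp 1 k), integral_fourier]
    have h₂ : ∀ N, birkhoffAverage ℂ U id N (fourierLp 1 k) =
        (N : ℂ)⁻¹ • ∑ n ∈ Finset.range N, fourierLp (T := T) 1 (k * (q : ℤ) ^ n) := by
      intro N
      simp only [birkhoffAverage, birkhoffSum, id]
      exact congrArg _ (Finset.sum_congr rfl fun n _ =>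
        compMeasurePreserving_iterate_fourierLp (by omega) k n)
    rw [h₁]
    simp_rw [h₂]
    split_ifs with hk
    · subst hk
      refine tendsto_const_nhds.congr' ?_
      filter_upwards [eventually_gt_atTop 0] with N hN
      have : (N : ℂ) ≠ 0 := by exact_mod_cast hN.ne'
      simp only [zero_mul, Finset.sum_const, Finset.card_range, one_smul]
      rw [← Nat.cast_smul_eq_nsmul ℂ, smul_smul, inv_mul_cancel₀ this, one_smul]
    · rw [zero_smul]
      refine squeeze_zero_norm' (a := fun N : ℕ => (Real.sqrt N)⁻¹) ?_ ?_
      · filter_upwards [eventually_gt_atTop 0] with N hN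
        exact norm_average_fourierLp_le hk hq hN
      · exact tendsto_inv_atTop_zero.comp
          (Real.tendsto_sqrt_atTop.comp tendsto_natCast_atTop_atTop)
  have htop : W = ⊤ := by
    have h := Submodule.topologicalClosure_minimal _ hspan hclosed
    rw [span_fourierLp_closure_eq_top (by simp)] at h
    exact top_le_iff.1 h
  have : f ∈ W := htop ▸ Submodule.mem_top
  exact this

/-- Along a suitable sequence of times, the averages of an integrable function along the orbits of
multiplication by `q` converge almost everywhere to its mean. -/
theorem exists_seq_tendsto_birkhoffAverage_nsmul {q : ℕ} (hq : 2 ≤ q) {H : AddCircle T → ℂ}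
    (hH : MemLp H 1 haarAddCircle) (h0 : ∫ x, H x ∂haarAddCircle = 0) :
    ∃ ns : ℕ → ℕ, StrictMono ns ∧ ∀ᵐ x ∂haarAddCircle (T := T),
      Tendsto (fun i => birkhoffAverage ℂ (fun y => q • y) H (ns i) x) atTop (𝓝 0) := by
  have hmp := measurePreserving_nsmul_haar (T := T) (q := q) (by omega)
  have h := tendsto_birkhoffAverage_Lp_nsmul hq (hH.toLp H)
  set U := Lp.compMeasurePreserving (E := ℂ) (p := 1) _ hmp with hU
  rw [integral_congr_ae hH.coeFn_toLp, h0, zero_smul] at h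
  obtain ⟨ns, hns, hae⟩ := (tendstoInMeasure_of_tendsto_Lp h).exists_seq_tendsto_ae
  refine ⟨ns, hns, ?_⟩
  -- Averages of classes must be matched with averages of the actual function `H`, up to null sets,
  -- for all `N` at once.
  have hcoe : ∀ N, ⇑(birkhoffAverage ℂ U id N (hH.toLp H) : Lp ℂ 1 haarAddCircle) =ᵐ[haarAddCircle] birkhoffAverage ℂ (fun y => q • y) H N := by
    intro N
    have h₁ : ∀ n, ⇑(U^[n] (hH.toLp H) : Lp ℂ 1 haarAddCircle) =ᵐ[haarAddCircle] fun x => H ((fun y => q • y)^[n] x) := by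
      intro n
      rw [hU, Lp.compMeasurePreserving_iterate]
      filter_upwards [Lp.coeFn_compMeasurePreserving (hH.toLp H) (hmp.iterate n),
        (hmp.iterate n).quasiMeasurePreserving.ae hH.coeFn_toLp] with x hx hx'
      rw [hx, Function.comp_apply, hx']
    filter_upwards [Lp.coeFn_smul (N : ℂ)⁻¹ (∑ n ∈ Finset.range N,
        U^[n] (hH.toLp H)),
      Lp.coeFn_finsetSum (Finset.range N) fun n =>
        U^[n] (hH.toLp H),
      ae_all_iff.2 h₁] with x hx₁ hx₂ hx₃
    simp only [birkhoffAverage, birkhoffSum, id]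
    rw [hx₁, Pi.smul_apply, hx₂]
    simp [hx₃]
  filter_upwards [hae, Lp.coeFn_zero ℂ 1 (haarAddCircle (T := T)), ae_all_iff.2 hcoe]
    with x hx h0 hx'
  rw [h0] at hx
  simpa only [hx', Pi.zero_apply] using hx

end Circle

/-! ### Cesàro-null series and summability almost everywhere -/

/-- The series all of whose tails have terms that tend to zero in Cesàro mean along the sequence
`ns` of times. -/
def cesaroNull (ns : ℕ → ℕ) : Submodule ℂ (ℕ → ℂ) where
  carrier := {x | ∀ j, Tendsto (fun i => (ns i : ℂ)⁻¹ * ∑ n ∈ Finset.range (ns i), x (n + j)) atTop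
    (𝓝 0)}
  add_mem' := fun hx hy j => by
    simpa [Finset.sum_add_distrib, mul_add] using (hx j).add (hy j)
  zero_mem' := fun j => by simp
  smul_mem' := fun c x hx j => by
    simpa [← Finset.mul_sum, mul_left_comm c] using (hx j).const_mul c

theorem seriesShift_mem_cesaroNull {ns : ℕ → ℕ} {x : ℕ → ℂ} (hx : x ∈ cesaroNull ns) :
    seriesShift x ∈ cesaroNull ns := fun j => by
  simpa [seriesShift, add_assoc] using hx (j + 1)

theorem eq_zero_of_mem_cesaroNull {ns : ℕ → ℕ} (hns : StrictMono ns) {x : ℕ → ℂ}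
    (hx : x ∈ cesaroNull ns) (hc : seriesShift x = x) : x 0 = 0 := by
  have h : ∀ n, x n = x 0 := by
    intro n
    induction n with
    | zero => rfl
    | succ n ih => rw [← ih]; exact congrFun hc n
  refine tendsto_nhds_unique (tendsto_const_nhds.congr' ?_) (hx 0)
  filter_upwards [hns.tendsto_atTop.eventually (eventually_gt_atTop 0)] with i hi
  have : (ns i : ℂ) ≠ 0 := by exact_mod_cast hi.ne'
  simp [h, this]

/-- With `A` the set of all points whose series lies in the domain, its invariance and periodicity
are inherited from the domain and from `θ`. -/
theorem exists_ae_sumsOn_orbitalSeries {T : ℝ} [hT : Fact (0 < T)] {q : ℕ} (hq : 2 ≤ q)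
    {θ : ℝ → ℂ} (hθ : Function.Periodic θ T) (hi : IntervalIntegrable θ volume 0 T)
    (h0 : ∫ t in (0 : ℝ)..T, θ t = 0) :
    ∃ (σ : SummationMethod) (A : Set ℝ) (ψ : ℝ → ℂ),
      (∀ᵐ t : ℝ, t ∈ A) ∧ (∀ t : ℝ, t + T ∈ A ↔ t ∈ A) ∧ (∀ t ∈ A, (q : ℝ) * t ∈ A) ∧
      Function.Periodic ψ T ∧ σ.SumsOn (orbitalSeries q θ) A ψ := by
  have hint : ∫ x, hθ.lift x ∂haarAddCircle (T := T) = 0 := by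
    rw [integral_periodic_lift, h0, smul_zero]
  have hH₁ := memLp_one_periodic_lift hθ hi
  have hH : ∀ t : ℝ, hθ.lift (t : AddCircle T) = θ t := fun t => hθ.lift_coe t
  generalize hθ.lift = H at hint hH₁ hH
  obtain ⟨ns, hns, hae⟩ := exists_seq_tendsto_birkhoffAverage_nsmul hq hH₁ hint
  obtain ⟨σ, hσ⟩ := exists_summationMethod (cesaroNull ns)
    (fun _ => seriesShift_mem_cesaroNull) (fun _ => eq_zero_of_mem_cesaroNull hns)
  refine ⟨σ, {t | orbitalSeries q θ t ∈ σ.domain}, fun t => σ.extendedSum (orbitalSeries q θ t),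
    ?_, ?_, ?_, ?_, σ.sumsOn_extendedSum _⟩
  -- The tail from index `j` is the orbital series of `q ^ j • x`, so convergence is needed along
  -- the whole forward orbit.
  · have h₁ := ae_forall_pow_nsmul (q := q) (by omega) hae
    filter_upwards [ae_coe_of_ae_addCircle (ae_haar_iff_ae_volume.1 h₁)] with t ht
    rw [hσ]
    intro j
    convert ht j using 2 with i
    simp only [birkhoffAverage, birkhoffSum, smul_eq_mul]
    congr 1
    refine Finset.sum_congr rfl fun n _ => ?_
    rw [smul_iterate_apply, smul_smul, ← pow_add, ← AddCircle.coe_nsmul, hH]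
    simp [orbitalSeries]
  · intro t
    simp only [Set.mem_ofPred_eq, orbitalSeries_add_period q hθ]
  · intro t ht
    rw [Set.mem_ofPred_eq, ← seriesShift_orbitalSeries]
    exact σ.shift_mem _ ht
  · intro t
    simp only [orbitalSeries_add_period q hθ]

/-- Neither `A` nor `ψ` need be periodic, and `A` need not be invariant. Replacing `ψ` by
`extendedSum` changes it only on a null set and makes it periodic everywhere; shift-invariance of
the domain yields the equation even where `q * t` leaves `A`. -/
theorem not_nullMeasurable_of_sumsOn_orbitalSeries {T : ℝ} {q : ℕ} {θ : ℝ → ℂ}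
    (hθ : Function.Periodic θ T)
    (hnm : ∀ φ : ℝ → ℂ, Function.Periodic φ T → (∀ᵐ t : ℝ, φ t - φ (q * t) = θ t) →
      ¬ NullMeasurable φ volume)
    {σ : SummationMethod} {A : Set ℝ} {ψ : ℝ → ℂ} (hA : ∀ᵐ t : ℝ, t ∈ A)
    (h : σ.SumsOn (orbitalSeries q θ) A ψ) : ¬ NullMeasurable ψ volume := by
  intro hm
  refine hnm (fun t => σ.extendedSum (orbitalSeries q θ t)) (fun t => ?_) ?_ (hm.congr ?_)
  · simp only [orbitalSeries_add_period q hθ]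
  · filter_upwards [hA] with t ht
    have h₁ : orbitalSeries q θ t ∈ σ.domain := (h t ht).1
    have h₂ : orbitalSeries q θ (q * t) ∈ σ.domain := by
      rw [← seriesShift_orbitalSeries]
      exact σ.shift_mem _ h₁
    have h₃ := (σ.sumsOn_extendedSum (orbitalSeries q θ)).sub_eq h₁ h₂
      (seriesShift_orbitalSeries q θ t)
    simpa [orbitalSeries] using h₃
  · filter_upwards [hA] with t ht
    exact h.eq_extendedSum ht

/-! ### Second and fourth moments of lacunary sums -/

/-- If `a < c`, dividing by `q ^ a` makes the right side a multiple of `q` and the left side `1 + q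
^ u`. For `u > 0` this forces `q ∣ 1`; for `u = 0` the left side is 2 and the right at least 4.
Symmetry excludes `c < a`. -/
theorem pow_add_pow_eq_iff_of_le {q : ℕ} (hq : 2 ≤ q) {a b c d : ℕ} (hab : a ≤ b) (hcd : c ≤ d)
    (h : q ^ a + q ^ b = q ^ c + q ^ d) : a = c ∧ b = d := by
  have key : ∀ {a b c d : ℕ}, a ≤ b → c ≤ d → q ^ a + q ^ b = q ^ c + q ^ d → ¬ a < c := by
    intro a b c d hab hcd h hac
    obtain ⟨u, rfl⟩ := Nat.exists_eq_add_of_le hab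
    obtain ⟨v, rfl⟩ := Nat.exists_eq_add_of_lt hac
    obtain ⟨w, rfl⟩ := Nat.exists_eq_add_of_le hcd
    have hqa : 0 < q ^ a := by positivity
    have h₁ : 1 + q ^ u = q * (q ^ v + q ^ (v + w)) := by
      apply Nat.eq_of_mul_eq_mul_left hqa
      calc q ^ a * (1 + q ^ u) = q ^ a + q ^ (a + u) := by ring
        _ = _ := h
        _ = _ := by ring
    have hv : 1 ≤ q ^ v := Nat.one_le_pow _ _ (by omega)
    have hw : 1 ≤ q ^ (v + w) := Nat.one_le_pow _ _ (by omega)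
    rcases Nat.eq_zero_or_pos u with rfl | hu
    · nlinarith
    · have h₂ : q ∣ 1 + q ^ u := h₁ ▸ dvd_mul_right _ _
      have h₃ : q ∣ 1 := (Nat.dvd_add_left (dvd_pow_self q hu.ne')).1 h₂
      have := Nat.le_of_dvd one_pos h₃
      omega
  have hac : a = c := le_antisymm (not_lt.1 (key hcd hab h.symm)) (not_lt.1 (key hab hcd h))
  subst hac
  exact ⟨rfl, Nat.pow_right_injective hq (Nat.add_left_cancel h)⟩

theorem pow_add_pow_eq {q : ℕ} (hq : 2 ≤ q) {a b c d : ℕ} (h : q ^ a + q ^ b = q ^ c + q ^ d) :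
    (c, d) = (a, b) ∨ (c, d) = (b, a) := by
  rcases le_total a b with hab | hab <;> rcases le_total c d with hcd | hcd
  · obtain ⟨rfl, rfl⟩ := pow_add_pow_eq_iff_of_le hq hab hcd h
    simp
  · obtain ⟨rfl, rfl⟩ := pow_add_pow_eq_iff_of_le hq hab hcd (by omega)
    simp
  · obtain ⟨rfl, rfl⟩ := pow_add_pow_eq_iff_of_le hq hab hcd (by omega)
    simp
  · obtain ⟨rfl, rfl⟩ := pow_add_pow_eq_iff_of_le hq hab hcd (by omega)
    simp

section Circle
variable {T : ℝ} [hT : Fact (0 < T)]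

theorem integrable_haar_of_continuous {E : Type*} [NormedAddCommGroup E] {f : AddCircle T → E}
    (hf : Continuous f) : Integrable f (haarAddCircle (T := T)) :=
  hf.integrable_of_hasCompactSupport (HasCompactSupport.of_compactSpace _)

/-- The square of the sum is an exponential sum over pairs, and each frequency comes from at most
two pairs, one the swap of the other. -/
theorem integral_norm_pow_four_lacunary_le {k : ℤ} (hk : k ≠ 0) {q : ℕ} (hq : 2 ≤ q) (N : ℕ) :
    ∫ x, ‖∑ n ∈ Finset.range N, fourier (k * (q : ℤ) ^ n) x‖ ^ 4 ∂haarAddCircle (T := T) ≤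
      2 * (N : ℝ) ^ 2 := by
  have h : ∀ x : AddCircle T, ‖∑ n ∈ Finset.range N, fourier (k * (q : ℤ) ^ n) x‖ ^ 4 =
      ‖∑ p ∈ Finset.range N ×ˢ Finset.range N,
        fourier (k * (q : ℤ) ^ p.1 + k * (q : ℤ) ^ p.2) x‖ ^ 2 := by
    intro x
    rw [Finset.sum_product, show 4 = 2 * 2 from rfl, pow_mul, ← norm_pow,
      sq (∑ n ∈ Finset.range N, _), Finset.sum_mul_sum]
    simp_rw [fourier_add]
  simp_rw [h]
  rw [integral_norm_sq_sum_fourier_eq_card]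
  calc _ ≤ ∑ p ∈ Finset.range N ×ˢ Finset.range N, (2 : ℝ) := by
        refine Finset.sum_le_sum fun p _ => ?_
        have h₁ : (Finset.range N ×ˢ Finset.range N).filter (fun r : ℕ × ℕ =>
            k * (q : ℤ) ^ p.1 + k * (q : ℤ) ^ p.2 = k * (q : ℤ) ^ r.1 + k * (q : ℤ) ^ r.2) ⊆
            {(p.1, p.2), (p.2, p.1)} := by
          intro r hr
          have h₂ := (Finset.mem_filter.1 hr).2
          rw [← mul_add, ← mul_add] at h₂
          have h₃ : q ^ p.1 + q ^ p.2 = q ^ r.1 + q ^ r.2 := by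
            exact_mod_cast mul_left_cancel₀ hk h₂
          simpa using pow_add_pow_eq hq h₃
        exact_mod_cast (Finset.card_le_card h₁).trans Finset.card_le_two
    _ = _ := by
        simp
        ring

/-- The power mean inequality separates the orbits, so no cross terms between different `j` arise.
-/
theorem integral_norm_pow_four_le {J : Type*} [Fintype J] {q : ℕ} (hq : 2 ≤ q) (k : J → ℤ)
    (hk : ∀ j, k j ≠ 0) (c : J → ℂ) (N : ℕ) :
    ∫ x, ‖∑ j, c j * ∑ n ∈ Finset.range N, fourier (k j * (q : ℤ) ^ n) x‖ ^ 4
        ∂haarAddCircle (T := T) ≤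
      (2 * (Fintype.card J : ℝ) ^ 3 * ∑ j, ‖c j‖ ^ 4) * (N : ℝ) ^ 2 := by
  calc _ ≤ ∫ x, (Fintype.card J : ℝ) ^ 3 * ∑ j, ‖c j‖ ^ 4 *
          ‖∑ n ∈ Finset.range N, fourier (k j * (q : ℤ) ^ n) x‖ ^ 4 ∂haarAddCircle (T := T) := by
        refine integral_mono (integrable_haar_of_continuous (by fun_prop))
          (integrable_haar_of_continuous (by fun_prop)) fun x => ?_
        refine (pow_le_pow_left₀ (norm_nonneg _) (norm_sum_le _ _) 4).trans ?_
        refine (pow_sum_le_card_mul_sum_pow (fun j _ => norm_nonneg _) 3).trans_eq ?_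
        simp [mul_pow]
    _ = (Fintype.card J : ℝ) ^ 3 * ∑ j, ‖c j‖ ^ 4 * ∫ x,
          ‖∑ n ∈ Finset.range N, fourier (k j * (q : ℤ) ^ n) x‖ ^ 4 ∂haarAddCircle (T := T) := by
        rw [integral_const_mul, integral_finsetSum _ fun j _ =>
          integrable_haar_of_continuous (by fun_prop)]
        simp_rw [integral_const_mul]
    _ ≤ (Fintype.card J : ℝ) ^ 3 * ∑ j, ‖c j‖ ^ 4 * (2 * (N : ℝ) ^ 2) := by
        gcongr with j _
        exact integral_norm_pow_four_lacunary_le (hk j) hq N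
    _ = _ := by
        rw [← Finset.sum_mul]
        ring

theorem integral_norm_sq_eq {J : Type*} [Fintype J] {q : ℕ} (k : J → ℤ) (c : J → ℂ)
    (hinj : Function.Injective fun p : J × ℕ => k p.1 * (q : ℤ) ^ p.2) (N : ℕ) :
    ∫ x, ‖∑ j, c j * ∑ n ∈ Finset.range N, fourier (k j * (q : ℤ) ^ n) x‖ ^ 2
        ∂haarAddCircle (T := T) = N * ∑ j, ‖c j‖ ^ 2 := by
  have h := integral_norm_sq_sum_fourier_of_injOn (T := T) (Finset.univ ×ˢ Finset.range N)
    (fun p : J × ℕ => k p.1 * (q : ℤ) ^ p.2) (fun p => c p.1) hinj.injOn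
  simp_rw [Finset.sum_product, ← Finset.mul_sum] at h
  rw [h]
  simp [Finset.mul_sum]

/-! ### Measurable coboundaries -/

/-- The tails of a measurable function on a probability space tend to zero. -/
theorem tendsto_integral_indicator_lt_norm {Ω : Type*} [MeasurableSpace Ω] {μ : Measure Ω}
    [IsProbabilityMeasure μ] {f : Ω → ℂ} (hf : AEStronglyMeasurable f μ) :
    Tendsto (fun M : ℕ => ∫ x, {x | (M : ℝ) < ‖f x‖}.indicator (fun _ => (1 : ℝ)) x ∂μ) atTop
      (𝓝 0) := by
  have hm : ∀ M : ℕ, NullMeasurableSet {x | (M : ℝ) < ‖f x‖} μ := fun M =>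
    nullMeasurableSet_lt aemeasurable_const hf.norm.aemeasurable
  have := tendsto_integral_of_dominated_convergence (μ := μ)
    (F := fun (M : ℕ) x => {x | (M : ℝ) < ‖f x‖}.indicator (fun _ => (1 : ℝ)) x)
    (f := fun _ => 0) (fun _ => 1)
    (fun M => (aestronglyMeasurable_const).indicator₀ (hm M)) (integrable_const _)
    (fun M => .of_forall fun x => by
      by_cases h : x ∈ {x | (M : ℝ) < ‖f x‖} <;> simp [h])
    (.of_forall fun x => by
      refine tendsto_const_nhds.congr' ?_
      filter_upwards [eventually_ge_atTop ⌈‖f x‖⌉₊] with M hM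
      have : ‖f x‖ ≤ M := (Nat.le_ceil _).trans (by exact_mod_cast hM)
      simp [this])
  simpa using this

/-- Packaging the exceptional set as a function `b` lets it enter a pointwise inequality and be
integrated directly. -/
theorem exists_integrable_majorant_indicator_lt_norm {Ω : Type*} [MeasurableSpace Ω] {μ : Measure Ω}
    [IsProbabilityMeasure μ] {f : Ω → ℂ} (hf : AEStronglyMeasurable f μ) {δ : ℝ} (hδ : 0 < δ) :
    ∃ (M : ℕ) (b : Ω → ℝ), Integrable b μ ∧ (∀ x, 0 ≤ b x) ∧
      (∀ x, (M : ℝ) < ‖f x‖ → b x = 1) ∧ ∫ x, b x ∂μ < δ := by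
  obtain ⟨M, hM⟩ := ((tendsto_integral_indicator_lt_norm hf).eventually (gt_mem_nhds hδ)).exists
  refine ⟨M, {x | (M : ℝ) < ‖f x‖}.indicator (fun _ => (1 : ℝ)), ?_, fun x => ?_, fun x hx => ?_, hM⟩
  · exact (integrable_const (1 : ℝ)).indicator₀
      (nullMeasurableSet_lt aemeasurable_const hf.norm.aemeasurable)
  · exact Set.indicator_nonneg (fun _ _ => zero_le_one) x
  · simp [hx]

theorem integral_comp_measurePreserving {Ω : Type*} [MeasurableSpace Ω] {μ : Measure Ω} {f : Ω → Ω}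
    (hf : MeasurePreserving f μ μ) {b : Ω → ℝ} (hb : Integrable b μ) :
    ∫ x, b (f x) ∂μ = ∫ x, b x ∂μ := by
  have h := integral_map (μ := μ) hf.aemeasurable (f := b)
    (by rw [hf.map_eq]; exact hb.aestronglyMeasurable)
  rw [hf.map_eq] at h
  exact h.symm

/-- A nonzero trigonometric polynomial with pairwise disjoint orbits of frequencies under `q` is
not the coboundary of a measurable function on the circle. -/
theorem not_ae_sub_comp_nsmul_eq_sum_fourier {J : Type*} [Fintype J] {q : ℕ} (hq : 2 ≤ q)
    {k : J → ℤ} (hk : ∀ j, k j ≠ 0) {c : J → ℂ} (hc : ∃ j, c j ≠ 0)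
    (hinj : Function.Injective fun p : J × ℕ => k p.1 * (q : ℤ) ^ p.2)
    {Ψ : AddCircle T → ℂ} (hΨ : AEStronglyMeasurable Ψ haarAddCircle) :
    ¬ ∀ᵐ x ∂haarAddCircle (T := T), Ψ x - Ψ (q • x) = ∑ j, c j * fourier (k j) x := by
  intro heq
  set S : ℕ → AddCircle T → ℂ := fun N x =>
    ∑ j, c j * ∑ n ∈ Finset.range N, fourier (k j * (q : ℤ) ^ n) x with hS
  have hmp : ∀ n : ℕ, MeasurePreserving (fun x : AddCircle T => q ^ n • x)
      haarAddCircle haarAddCircle := fun n =>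
    measurePreserving_nsmul_haar (pow_ne_zero _ (by omega))
  have htel : ∀ᵐ x ∂haarAddCircle (T := T), ∀ N : ℕ, Ψ x - Ψ (q ^ N • x) = S N x := by
    filter_upwards [ae_forall_pow_nsmul (q := q) (by omega) heq] with x hx N
    induction N with
    | zero => simp [hS]
    | succ N ih =>
      have h₂ := hx N
      rw [smul_smul, ← pow_succ'] at h₂
      have h₃ : S (N + 1) x = S N x + ∑ j, c j * fourier (k j) (q ^ N • x) := by
        simp only [hS, Finset.sum_range_succ, mul_add, Finset.sum_add_distrib]
        simp only [fourier_nsmul, Nat.cast_pow]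
      rw [h₃, ← ih, ← h₂]
      ring
  set B : ℝ := ∑ j, ‖c j‖ ^ 2 with hB
  set C : ℝ := 2 * (Fintype.card J : ℝ) ^ 3 * ∑ j, ‖c j‖ ^ 4 with hC
  have hBpos : 0 < B := by
    obtain ⟨j, hj⟩ := hc
    exact Finset.sum_pos' (fun _ _ => by positivity) ⟨j, Finset.mem_univ _, by positivity⟩
  have hC0 : 0 ≤ C := by positivity
  -- Small enough that the fourth moment term costs at most `N * B / 4`; the 1 spares a proof that
  -- `C` is nonzero.
  set η : ℝ := B / (4 * (C + 1)) with hη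
  have hη0 : 0 < η := by positivity
  have hηC : η * C ≤ B / 4 := by
    rw [hη, div_mul_eq_mul_div, div_le_div_iff₀ (by positivity) (by norm_num)]
    nlinarith
  -- With this tail bound the two exceptional sets together also cost at most `N * B / 4`, leaving
  -- half of the second moment `N * B`.
  obtain ⟨M, b, hbi, hb0, hb1, hM⟩ := exists_integrable_majorant_indicator_lt_norm hΨ
    (show 0 < η * B / 2 by positivity)
  have hbN : ∀ N : ℕ, Integrable (fun x => b (q ^ N • x)) haarAddCircle := fun N =>
    (hmp N).integrable_comp_of_integrable hbi
  have hbNint : ∀ N : ℕ, ∫ x, b (q ^ N • x) ∂haarAddCircle = ∫ x, b x ∂haarAddCircle :=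
    fun N => integral_comp_measurePreserving (hmp N) hbi
  have hSc : ∀ N, Continuous (S N) := fun N => by
    simp only [hS]
    fun_prop
  have hmain : ∀ N : ℕ, 0 < N → (N : ℝ) * (B / 2) ≤ 4 * (M : ℝ) ^ 2 := by
    intro N hN
    have hN' : (0 : ℝ) < N := by exact_mod_cast hN
    -- Where both values of `Ψ` are at most `M`, the first term suffices. Elsewhere `b` contributes
    -- at least 1 and `s ≤ η / N * s ^ 2 + N / (4 * η)` applies with `s = ‖S N x‖ ^ 2`.
    have hpt : ∀ᵐ x ∂haarAddCircle (T := T), ‖S N x‖ ^ 2 ≤ 4 * (M : ℝ) ^ 2 +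
        η / N * ‖S N x‖ ^ 4 + N / (4 * η) * (b x + b (q ^ N • x)) := by
      filter_upwards [htel] with x hx
      have h₁ : ‖S N x‖ ≤ ‖Ψ x‖ + ‖Ψ (q ^ N • x)‖ := by
        rw [← hx N]
        exact norm_sub_le _ _
      have hbb : 0 ≤ N / (4 * η) * (b x + b (q ^ N • x)) :=
        mul_nonneg (by positivity) (add_nonneg (hb0 _) (hb0 _))
      by_cases h : (M : ℝ) < ‖Ψ x‖ ∨ (M : ℝ) < ‖Ψ (q ^ N • x)‖
      · have h₂ : 1 ≤ b x + b (q ^ N • x) := by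
          rcases h with h | h
          · rw [hb1 _ h]; linarith [hb0 (q ^ N • x)]
          · rw [hb1 _ h]; linarith [hb0 x]
        have h₃ : N / (4 * η) * 1 ≤ N / (4 * η) * (b x + b (q ^ N • x)) := by gcongr
        have h₄ : η / N * ‖S N x‖ ^ 4 + N / (4 * η) * 1 - ‖S N x‖ ^ 2 =
            η / N * (‖S N x‖ ^ 2 - N / (2 * η)) ^ 2 := by
          field_simp
          ring
        have h₅ : 0 ≤ η / N * (‖S N x‖ ^ 2 - N / (2 * η)) ^ 2 := by positivity
        nlinarith [sq_nonneg (M : ℝ)]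
      · push Not at h
        have h₂ : ‖S N x‖ ≤ 2 * M := by linarith [h.1, h.2]
        have h₃ : ‖S N x‖ ^ 2 ≤ (2 * M) ^ 2 := by gcongr
        have h₄ : 0 ≤ η / N * ‖S N x‖ ^ 4 := by positivity
        nlinarith
    have hint : ∫ x, ‖S N x‖ ^ 2 ∂haarAddCircle ≤ 4 * (M : ℝ) ^ 2 +
        η / N * ∫ x, ‖S N x‖ ^ 4 ∂haarAddCircle +
        N / (4 * η) * (∫ x, b x ∂haarAddCircle + ∫ x, b x ∂haarAddCircle) := by
      have h4 : Integrable (fun x => η / N * ‖S N x‖ ^ 4) haarAddCircle :=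
        (integrable_haar_of_continuous ((hSc N).norm.pow 4)).const_mul _
      have hbs : Integrable (fun x => N / (4 * η) * (b x + b (q ^ N • x))) haarAddCircle :=
        (hbi.add (hbN N)).const_mul _
      have h5 : Integrable (fun x => 4 * (M : ℝ) ^ 2 + η / N * ‖S N x‖ ^ 4) haarAddCircle :=
        (integrable_const _).add h4
      refine (integral_mono_ae (integrable_haar_of_continuous ((hSc N).norm.pow 2))
        (h5.add hbs) hpt).trans_eq ?_
      simp only [Pi.add_apply]
      rw [integral_add h5 hbs, integral_add (integrable_const _) h4,
        integral_const, integral_const_mul, integral_const_mul, integral_add hbi (hbN N), hbNint]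
      simp
    have h2 := integral_norm_sq_eq (T := T) k c hinj N
    have h4 := integral_norm_pow_four_le (T := T) hq k hk c N
    rw [h2] at hint
    have h₁ : η / N * ∫ x, ‖S N x‖ ^ 4 ∂haarAddCircle ≤ N * (B / 4) := by
      calc _ ≤ η / N * (C * (N : ℝ) ^ 2) := by gcongr
        _ = N * (η * C) := by field_simp
        _ ≤ _ := by gcongr
    have h₂ : N / (4 * η) * (∫ x, b x ∂haarAddCircle + ∫ x, b x ∂haarAddCircle) ≤ N * (B / 4) := by
      calc _ ≤ N / (4 * η) * (η * B / 2 + η * B / 2) := by gcongr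
        _ = _ := by field_simp; norm_num
    linarith
  obtain ⟨N, hN⟩ := exists_nat_gt (4 * (M : ℝ) ^ 2 / (B / 2))
  rw [div_lt_iff₀ (by positivity)] at hN
  have hN0 : 0 < N := by
    rcases Nat.eq_zero_or_pos N with rfl | h
    · norm_num at hN
      nlinarith [sq_nonneg (M : ℝ)]
    · exact h
  linarith [hmain N hN0]

end Circle

/-! ### Trigonometric polynomials on the line -/

theorem fourier_two_pi_coe (k : ℤ) (t : ℝ) :
    fourier k (t : AddCircle (2 * Real.pi)) = Complex.exp (k * t * Complex.I) := by
  rw [fourier_coe_apply]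
  congr 1
  have : (Real.pi : ℂ) ≠ 0 := by exact_mod_cast Real.pi_ne_zero
  push_cast
  field_simp

theorem cos_add_sin_eq_fourier (n : ℕ) (a b : ℂ) (t : ℝ) :
    a * (Real.cos (n * t) : ℂ) + b * (Real.sin (n * t) : ℂ) =
      (a - b * Complex.I) / 2 * fourier (n : ℤ) (t : AddCircle (2 * Real.pi)) +
        (a + b * Complex.I) / 2 * fourier (-(n : ℤ)) (t : AddCircle (2 * Real.pi)) := by
  rw [fourier_two_pi_coe, fourier_two_pi_coe, Complex.ofReal_cos, Complex.ofReal_sin, Complex.cos,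
    Complex.sin]
  push_cast
  simp only [neg_mul]
  ring_nf

/-- The ratio condition separates the orbits of different `ν i`, and the sign separates those of `ν
i` and `-ν i`. -/
theorem injective_signed_mul_pow {m q : ℕ} (hq : 2 ≤ q) {ν : Fin m → ℕ} (hν : ∀ i, 0 < ν i)
    (hr : ∀ i j, j < i → ∀ k : ℤ, (ν i : ℝ) / (ν j : ℝ) ≠ (q : ℝ) ^ k) :
    Function.Injective fun p : (Fin m × Bool) × ℕ =>
      (if p.1.2 then (ν p.1.1 : ℤ) else -(ν p.1.1 : ℤ)) * (q : ℤ) ^ p.2 := by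
  have hne : ∀ i j : Fin m, ∀ n l : ℕ, j < i → ν i * q ^ n ≠ ν j * q ^ l := by
    intro i j n l hji h
    apply hr i j hji ((l : ℤ) - n)
    have hq0 : (q : ℝ) ≠ 0 := by positivity
    have hj : (ν j : ℝ) ≠ 0 := by exact_mod_cast (hν j).ne'
    rw [zpow_sub₀ hq0, zpow_natCast, zpow_natCast, div_eq_div_iff hj (pow_ne_zero _ hq0)]
    have : (ν i : ℝ) * (q : ℝ) ^ n = ν j * (q : ℝ) ^ l := by exact_mod_cast h
    rw [this, mul_comm]
  have key : ∀ i j : Fin m, ∀ n l : ℕ, ν i * q ^ n = ν j * q ^ l → i = j ∧ n = l := by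
    intro i j n l h
    have hij : i = j := by
      rcases lt_trichotomy i j with h' | h' | h'
      · exact absurd h.symm (hne j i l n h')
      · exact h'
      · exact absurd h (hne i j n l h')
    subst hij
    exact ⟨rfl, Nat.pow_right_injective hq (Nat.eq_of_mul_eq_mul_left (hν i) h)⟩
  have hpos : ∀ (i : Fin m) (n : ℕ), (0 : ℤ) < ν i * (q : ℤ) ^ n := by
    intro i n
    have := hν i
    positivity
  rintro ⟨⟨i, s⟩, n⟩ ⟨⟨j, s'⟩, l⟩ h
  have h₁ := hpos i n
  have h₂ := hpos j l
  cases s <;> cases s' <;> simp only [if_true, Bool.false_eq_true, if_false, neg_mul] at h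
  · obtain ⟨rfl, rfl⟩ := key i j n l (by exact_mod_cast neg_injective h)
    rfl
  · omega
  · omega
  · obtain ⟨rfl, rfl⟩ := key i j n l (by exact_mod_cast h)
    rfl

/-- A nonzero trigonometric polynomial no frequency ratio of which is a power of `q` is not the
coboundary of a measurable periodic function. -/
theorem not_nullMeasurable_of_ae_sub_eq_trigPoly {q : ℕ} (hq : 2 ≤ q) {m : ℕ} {ν : Fin m → ℕ}
    {a b : Fin m → ℂ} (hν : ∀ i, 0 < ν i) (hab : ∃ i, a i ≠ 0 ∨ b i ≠ 0)
    (hr : ∀ i j, j < i → ∀ k : ℤ, (ν i : ℝ) / (ν j : ℝ) ≠ (q : ℝ) ^ k)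
    {ψ : ℝ → ℂ} (hψ : Function.Periodic ψ (2 * Real.pi))
    (heq : ∀ᵐ t : ℝ, ψ t - ψ ((q : ℝ) * t) =
      ∑ i, (a i * (Real.cos (ν i * t) : ℂ) + b i * (Real.sin (ν i * t) : ℂ))) :
    ¬ NullMeasurable ψ volume := by
  intro hm
  have hT : Fact (0 < 2 * Real.pi) := ⟨Real.two_pi_pos⟩
  have hΨ := aestronglyMeasurable_periodic_lift hψ hm.aemeasurable.aestronglyMeasurable
  have hlift : ∀ t : ℝ, hψ.lift (t : AddCircle (2 * Real.pi)) = ψ t := fun t => hψ.lift_coe t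
  generalize hψ.lift = Ψ at hΨ hlift
  -- Each real frequency splits into two characters; the `Bool` records the sign.
  refine not_ae_sub_comp_nsmul_eq_sum_fourier hq (J := Fin m × Bool)
    (k := fun p => if p.2 then (ν p.1 : ℤ) else -(ν p.1 : ℤ))
    (c := fun p => if p.2 then (a p.1 - b p.1 * Complex.I) / 2 else
      (a p.1 + b p.1 * Complex.I) / 2) ?_ ?_ (injective_signed_mul_pow hq hν hr) hΨ ?_
  · rintro ⟨i, s⟩
    have := hν i
    cases s <;> simp <;> omega
  · obtain ⟨i, hi⟩ := hab
    by_contra! h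
    have h₁ := h (i, true)
    have h₂ := h (i, false)
    simp only [if_true, Bool.false_eq_true, if_false] at h₁ h₂
    have ha : a i = 0 := by linear_combination h₁ + h₂
    have hb : b i = 0 := by
      have : b i * Complex.I = 0 := by linear_combination h₂ - h₁
      simpa using this
    simp [ha, hb] at hi
  · refine ae_haar_iff_ae_volume.2 (ae_addCircle_of_ae_coe ?_)
    filter_upwards [heq] with t ht
    have h₁ : q • (t : AddCircle (2 * Real.pi)) = ((q * t : ℝ) : AddCircle (2 * Real.pi)) := by
      rw [← AddCircle.coe_nsmul, nsmul_eq_mul]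
    rw [h₁, hlift, hlift, ht, Fintype.sum_prod_type]
    refine Finset.sum_congr rfl fun i _ => ?_
    rw [cos_add_sin_eq_fourier]
    simp

theorem exists_ae_sumsOn_of_continuous {q : ℕ} (hq : 2 ≤ q) {θ : ℝ → ℂ}
    (hθ : Function.Periodic θ (2 * Real.pi)) (hc : Continuous θ)
    (h0 : ∫ t in (0 : ℝ)..(2 * Real.pi), θ t = 0) :
    ∃ (σ : SummationMethod) (A : Set ℝ) (ψ : ℝ → ℂ), (∀ᵐ t : ℝ, t ∈ A) ∧
      σ.SumsOn (orbitalSeries q θ) A ψ := by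
  have hT : Fact (0 < 2 * Real.pi) := ⟨Real.two_pi_pos⟩
  obtain ⟨σ, A, ψ, hA, -, -, -, h⟩ :=
    exists_ae_sumsOn_orbitalSeries hq hθ (hc.intervalIntegrable _ _) h0
  exact ⟨σ, A, ψ, hA, h⟩

theorem periodic_ofReal_sin : Function.Periodic (fun t : ℝ => (Real.sin t : ℂ)) (2 * Real.pi) :=
  fun t => congrArg _ (Real.sin_periodic t)

theorem periodic_ofReal_cos : Function.Periodic (fun t : ℝ => (Real.cos t : ℂ)) (2 * Real.pi) :=
  fun t => congrArg _ (Real.cos_periodic t)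

/-! ### The main theorem -/

theorem theorem4p5 :
    (∀ q : ℕ, 2 ≤ q →
      -- `θ` is `2π`-periodic, integrable over a period, with mean value zero
      (∀ θ : ℝ → ℂ, Function.Periodic θ (2 * Real.pi) →
        IntervalIntegrable θ MeasureTheory.volume 0 (2 * Real.pi) →
        ∫ t in (0 : ℝ)..(2 * Real.pi), θ t = 0 →
        -- one method sums the series on an invariant periodic set of full measure
        (∃ (σ : SummationMethod) (A : Set ℝ) (ψ : ℝ → ℂ),
          (∀ᵐ t : ℝ, t ∈ A) ∧ (∀ t : ℝ, t + 2 * Real.pi ∈ A ↔ t ∈ A) ∧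
          (∀ t ∈ A, (q : ℝ) * t ∈ A) ∧ Function.Periodic ψ (2 * Real.pi) ∧
          σ.SumsOn (orbitalSeries q θ) A ψ) ∧
        -- every sum of the series solves the cohomological equation
        (∀ (σ : SummationMethod) (A : Set ℝ) (ψ : ℝ → ℂ),
          (∀ t ∈ A, (q : ℝ) * t ∈ A) → σ.SumsOn (orbitalSeries q θ) A ψ →
          ∀ t ∈ A, ψ t - ψ ((q : ℝ) * t) = θ t)) ∧
      -- for a nonzero trigonometric polynomial no frequency ratio of which is a power of `q`,
      -- no solution (even almost everywhere) is Lebesgue measurable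
      (∀ (m : ℕ) (ν : Fin m → ℕ) (a b : Fin m → ℂ),
        (∀ i, 0 < ν i) → (∃ i, a i ≠ 0 ∨ b i ≠ 0) →
        (∀ i j, j < i → ∀ k : ℤ, (ν i : ℝ) / (ν j : ℝ) ≠ (q : ℝ) ^ k) →
        ∀ ψ : ℝ → ℂ, Function.Periodic ψ (2 * Real.pi) →
          (∀ᵐ t : ℝ, ψ t - ψ ((q : ℝ) * t) =
            ∑ i, (a i * (Real.cos (ν i * t) : ℂ) + b i * (Real.sin (ν i * t) : ℂ))) →
          ¬ MeasureTheory.NullMeasurable ψ MeasureTheory.volume)) ∧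
    -- the series of `sin 3ⁿt` is summable almost everywhere, and every sum of it is nonmeasurable
    ((∃ (σ : SummationMethod) (A : Set ℝ) (ψ : ℝ → ℂ), (∀ᵐ t : ℝ, t ∈ A) ∧
        σ.SumsOn (fun t n => (Real.sin (3 ^ n * t) : ℂ)) A ψ) ∧
      ∀ (σ : SummationMethod) (A : Set ℝ) (ψ : ℝ → ℂ), (∀ᵐ t : ℝ, t ∈ A) →
        σ.SumsOn (fun t n => (Real.sin (3 ^ n * t) : ℂ)) A ψ →
        ¬ MeasureTheory.NullMeasurable ψ MeasureTheory.volume) ∧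
    -- the same for the series of `cos 2ⁿt`
    ((∃ (σ : SummationMethod) (A : Set ℝ) (ψ : ℝ → ℂ), (∀ᵐ t : ℝ, t ∈ A) ∧
        σ.SumsOn (fun t n => (Real.cos (2 ^ n * t) : ℂ)) A ψ) ∧
      ∀ (σ : SummationMethod) (A : Set ℝ) (ψ : ℝ → ℂ), (∀ᵐ t : ℝ, t ∈ A) →
        σ.SumsOn (fun t n => (Real.cos (2 ^ n * t) : ℂ)) A ψ →
        ¬ MeasureTheory.NullMeasurable ψ MeasureTheory.volume) := by
  have hsin : (fun (t : ℝ) (n : ℕ) => (Real.sin (3 ^ n * t) : ℂ)) =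
      orbitalSeries 3 fun t => (Real.sin t : ℂ) := by
    funext t n
    simp [orbitalSeries]
  have hcos : (fun (t : ℝ) (n : ℕ) => (Real.cos (2 ^ n * t) : ℂ)) =
      orbitalSeries 2 fun t => (Real.cos t : ℂ) := by
    funext t n
    simp [orbitalSeries]
  rw [hsin, hcos]
  refine ⟨fun q hq => ⟨fun θ hθ hi h0 => ⟨?_, ?_⟩, ?_⟩, ⟨?_, ?_⟩, ?_, ?_⟩
  · have hT : Fact (0 < 2 * Real.pi) := ⟨Real.two_pi_pos⟩
    exact exists_ae_sumsOn_orbitalSeries hq hθ hi h0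
  · intro σ A ψ hA h t ht
    have := h.sub_eq ht (hA t ht) (seriesShift_orbitalSeries q θ t)
    simpa [orbitalSeries] using this
  · intro m ν a b hν hab hr ψ hψ heq
    exact not_nullMeasurable_of_ae_sub_eq_trigPoly hq hν hab hr hψ heq
  · refine exists_ae_sumsOn_of_continuous (by norm_num) periodic_ofReal_sin (by fun_prop) ?_
    rw [intervalIntegral.integral_ofReal, integral_sin]
    simp
  · intro σ A ψ hA h
    refine not_nullMeasurable_of_sumsOn_orbitalSeries periodic_ofReal_sin (fun φ hφ heq => ?_) hA h
    -- A single frequency makes the ratio condition vacuous.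
    refine not_nullMeasurable_of_ae_sub_eq_trigPoly (q := 3) (m := 1) (ν := fun _ => 1)
      (a := fun _ => 0) (b := fun _ => 1) (by norm_num) (by simp) (by simp)
      (fun i j hij => absurd hij (by simp)) hφ ?_
    simpa using heq
  · refine exists_ae_sumsOn_of_continuous (by norm_num) periodic_ofReal_cos (by fun_prop) ?_
    rw [intervalIntegral.integral_ofReal, integral_cos]
    simp
  · intro σ A ψ hA h
    refine not_nullMeasurable_of_sumsOn_orbitalSeries periodic_ofReal_cos (fun φ hφ heq => ?_) hA h
    refine not_nullMeasurable_of_ae_sub_eq_trigPoly (q := 2) (m := 1) (ν := fun _ => 1)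
      (a := fun _ => 1) (b := fun _ => 0) (by norm_num) (by simp) (by simp)
      (fun i j hij => absurd hij (by simp)) hφ ?_
    simpa using heq
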